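/- Let $(a;p)_n=\prod_{j=0}^{n-1}(1-ap^{j})$ and $(a;p)_\infty=\prod_{j\ge 0}(1-ap^{j})$. Define integers $M_{C1}(m,n)$ and $M_{C5}(m,n)$, for $m\in\mathbb{Z}$ and $n\ge 1$, as the coefficients of $z^m q^n$ in the following formal power series in $q$ with coefficients in $\mathbb{Z}[z,z^{-1}]$: $$\sum_{n=1}^{\infty}\sum_{m=-\infty}^{\infty}M_{C1}(m,n)z^{m}q^{n}=\frac{(q;q^{2})_{\infty}(q;q)_{\infty}}{(z;q)_{\infty}(z^{-1};q)_{\infty}}\sum_{n=1}^{\infty}\frac{q^{n}(z;q)_{n}(z^{-1};q)_{n}}{(q;q^{2})_{n}(q;q)_{n}}=\sum_{n=1}^{\infty}\frac{q^{n}(q^{2n+1};q^{2})_{\infty}(q^{n+1};q)_{\infty}}{(zq^{n};q)_{\infty}(z^{-1}q^{n};q)_{\infty}},$$ $$\sum_{n=1}^{\infty}\sum_{m=-\infty}^{\infty}M_{C5}(m,n)z^{m}q^{n}=\frac{(q;q^{2})_{\infty}(q;q)_{\infty}}{(z;q)_{\infty}(z^{-1};q)_{\infty}}\sum_{n=1}^{\infty}\frac{q^{\frac{n^{2}+n}{2}}(z;q)_{n}(z^{-1};q)_{n}}{(q;q^{2})_{n}(q;q)_{n}}=\sum_{n=1}^{\infty}\frac{q^{\frac{n^{2}+n}{2}}(q^{2n+1};q^{2})_{\infty}(q^{n+1};q)_{\infty}}{(zq^{n};q)_{\infty}(z^{-1}q^{n};q)_{\infty}}.$$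 Then $M_{C1}(m,n)\ge 0$ and $M_{C5}(m,n)\ge 0$ for all integers $m$ and all positive integers $n$. -/

import Mathlib

namespace SptCrank

open scoped LaurentPolynomial PowerSeries.WithPiTopology

/-- Coefficients in `ℤ[z, z⁻¹]` carry the discrete topology, so that infinite sums and products in
`ℤ[z, z⁻¹]⟦q⟧` converge exactly when every coefficient of `q ^ n` is eventually constant. -/
instance instTopologicalSpaceLaurent : TopologicalSpace ℤ[T;T⁻¹] := ⊥

instance instDiscreteTopologyLaurent : DiscreteTopology ℤ[T;T⁻¹] := ⟨rfl⟩

/-- The ring `ℤ[z, z⁻¹]⟦q⟧` of formal power series in `q` over the Laurent polynomials in `z`. -/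
abbrev ZQ : Type := PowerSeries ℤ[T;T⁻¹]

/-- The variable `q`. -/
noncomputable def q : ZQ := PowerSeries.X

/-- The variable `z`. -/
noncomputable def z : ZQ := PowerSeries.C (LaurentPolynomial.T 1)

/-- The inverse `z⁻¹` of the variable `z`. -/
noncomputable def zInv : ZQ := PowerSeries.C (LaurentPolynomial.T (-1))

/-- The finite `q`-shifted factorial `(a; p)_n = ∏_{0 ≤ j < n} (1 - a p ^ j)`. -/
noncomputable def qPoch (a p : ZQ) (n : ℕ) : ZQ :=
  ∏ j ∈ Finset.range n, (1 - a * p ^ j)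

/-- The infinite `q`-shifted factorial `(a; p)_∞ = ∏_{j ≥ 0} (1 - a p ^ j)`. -/
noncomputable def qPochInf (a p : ZQ) : ZQ :=
  ∏' j : ℕ, (1 - a * p ^ j)

/-- The reciprocal `1 / f` of a power series `f` with constant coefficient `1`. -/
noncomputable def recip (f : ZQ) : ZQ := PowerSeries.invOfUnit f 1

/-- The two-variable series
`∑_{n ≥ 1} q ^ e(n) (q ^ (2n+1); q²)_∞ (q ^ (n+1); q)_∞ / ((z q ^ n; q)_∞ (z⁻¹ q ^ n; q)_∞)`. -/
noncomputable def sptSeries (e : ℕ → ℕ) : ZQ :=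
  ∑' k : ℕ, let n := k + 1
    q ^ e n * (qPochInf (q ^ (2 * n + 1)) (q ^ 2) * qPochInf (q ^ (n + 1)) q) *
      recip (qPochInf (z * q ^ n) q * qPochInf (zInv * q ^ n) q)

/-- The spt-crank-type series `S_{C1}(z, q)`. -/
noncomputable def SC1 : ZQ := sptSeries fun n => n

/-- The spt-crank-type series `S_{C5}(z, q)`. -/
noncomputable def SC5 : ZQ := sptSeries fun n => n * (n + 1) / 2

/-- `M_{C1}(m, n)`, the coefficient of `z ^ m q ^ n` in `S_{C1}(z, q)`. -/
noncomputable def MC1 (m : ℤ) (n : ℕ) : ℤ := (PowerSeries.coeff n SC1).coeff m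

/-- `M_{C5}(m, n)`, the coefficient of `z ^ m q ^ n` in `S_{C5}(z, q)`. -/
noncomputable def MC5 (m : ℤ) (n : ℕ) : ℤ := (PowerSeries.coeff n SC5).coeff m

/-! The infinite products and sums above converge, and `sptSeries e` is the series
`(q; q²)_∞ (q; q)_∞ / ((z; q)_∞ (z⁻¹; q)_∞) ∑_{n ≥ 1} q ^ e(n) (z; q)_n (z⁻¹; q)_n /
((q; q²)_n (q; q)_n)`, with the denominator `(z; q)_∞ (z⁻¹; q)_∞`, which is not a unit, multiplied
out. -/

theorem X_pow_dvd_order {f : ZQ} {n : ℕ} (h : q ^ n ∣ f) : (n : ℕ∞) ≤ f.order :=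
  PowerSeries.le_order f n fun i hi => PowerSeries.X_pow_dvd_iff.mp h i (by exact_mod_cast hi)

theorem tendsto_order_of_dvd {f : ℕ → ZQ} (h : ∀ j, q ^ j ∣ f j) :
    Filter.Tendsto (fun j => (f j).order) Filter.atTop (nhds ⊤) := by
  refine ENat.tendsto_nhds_top_iff_natCast_lt.mpr fun n => Filter.eventually_atTop.mpr ⟨n + 1, ?_⟩
  intro m hm
  refine lt_of_lt_of_le ?_ (X_pow_dvd_order (h m))
  exact_mod_cast hm

theorem multipliable_qPoch (a : ZQ) {p : ZQ} (hp : q ∣ p) :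
    Multipliable fun j : ℕ => 1 - a * p ^ j := by
  simp_rw [sub_eq_add_neg]
  refine PowerSeries.WithPiTopology.multipliable_one_add_of_tendsto_order_atTop_nhds_top _
    (tendsto_order_of_dvd fun j => ?_)
  exact (dvd_neg.mpr ((pow_dvd_pow_of_dvd hp j).mul_left a))

theorem qPoch_mul_qPochInf (a : ZQ) {p : ZQ} (hp : q ∣ p) (n : ℕ) :
    qPoch a p n * qPochInf (a * p ^ n) p = qPochInf a p := by
  have h : (fun j : ℕ => 1 - a * p ^ n * p ^ j) = fun j : ℕ => 1 - a * p ^ (j + n) := by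
    funext j; ring
  have hm := multipliable_qPoch (a * p ^ n) hp
  rw [h] at hm
  have := Multipliable.prod_mul_tprod_nat_mul' (f := fun j : ℕ => 1 - a * p ^ j) (k := n) hm
  rw [qPoch, qPochInf, qPochInf, h]
  exact this

theorem constantCoeff_qPochInf {a p : ZQ} (ha : q ∣ a) (hp : q ∣ p) :
    PowerSeries.constantCoeff (qPochInf a p) = 1 := by
  have ha' : PowerSeries.constantCoeff a = 0 := PowerSeries.X_dvd_iff.mp ha
  rw [qPochInf, (multipliable_qPoch a hp).map_tprod _
    (PowerSeries.WithPiTopology.continuous_constantCoeff _)]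
  simp [ha']

theorem constantCoeff_qPoch {a : ZQ} (p : ZQ) (ha : q ∣ a) (n : ℕ) :
    PowerSeries.constantCoeff (qPoch a p n) = 1 := by
  have ha' : PowerSeries.constantCoeff a = 0 := PowerSeries.X_dvd_iff.mp ha
  simp [qPoch, ha']

theorem mul_recip {f : ZQ} (h : PowerSeries.constantCoeff f = 1) : f * recip f = 1 :=
  PowerSeries.mul_invOfUnit f 1 (by simpa using h)

theorem summable_of_dvd {f : ℕ → ZQ} (h : ∀ j, q ^ j ∣ f j) : Summable f :=
  PowerSeries.WithPiTopology.summable_of_tendsto_order_atTop_nhds_top _ (tendsto_order_of_dvd h)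

theorem sptSeries_spec (e : ℕ → ℕ) (he : ∀ n, n ≤ e n) :
    qPochInf z q * qPochInf zInv q * sptSeries e =
      qPochInf q (q ^ 2) * qPochInf q q *
        ∑' k : ℕ, let n := k + 1
          q ^ e n * (qPoch z q n * qPoch zInv q n) * recip (qPoch q (q ^ 2) n * qPoch q q n) := by
  have hq2 : q ∣ q ^ 2 := dvd_pow_self q two_ne_zero
  have hd (k : ℕ) : q ^ k ∣ q ^ e (k + 1) := pow_dvd_pow q ((Nat.le_succ k).trans (he (k + 1)))
  rw [sptSeries, ← Summable.tsum_mul_left, ← Summable.tsum_mul_left]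
  · refine tsum_congr fun k => ?_
    dsimp only
    set n := k + 1 with hn
    have hqn : q ∣ q ^ n := dvd_pow_self q (by omega)
    have h1 := mul_recip (f := qPochInf (z * q ^ n) q * qPochInf (zInv * q ^ n) q) (by
      rw [map_mul, constantCoeff_qPochInf (hqn.mul_left _) dvd_rfl,
        constantCoeff_qPochInf (hqn.mul_left _) dvd_rfl, one_mul])
    have h2 := mul_recip (f := qPoch q (q ^ 2) n * qPoch q q n) (by
      rw [map_mul, constantCoeff_qPoch _ dvd_rfl, constantCoeff_qPoch _ dvd_rfl, one_mul])
    have e1 := qPoch_mul_qPochInf z (dvd_refl q) n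
    have e2 := qPoch_mul_qPochInf zInv (dvd_refl q) n
    have e3 := qPoch_mul_qPochInf q hq2 n
    have e4 := qPoch_mul_qPochInf q (dvd_refl q) n
    rw [show q * (q ^ 2) ^ n = q ^ (2 * n + 1) by ring] at e3
    rw [show q * q ^ n = q ^ (n + 1) by ring] at e4
    rw [← e1, ← e2, ← e3, ← e4]
    generalize recip (qPochInf (z * q ^ n) q * qPochInf (zInv * q ^ n) q) = r1 at *
    generalize recip (qPoch q (q ^ 2) n * qPoch q q n) = r2 at *
    calc _ = (qPochInf (z * q ^ n) q * qPochInf (zInv * q ^ n) q * r1) *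
          (qPoch z q n * qPoch zInv q n * q ^ e n *
            (qPochInf (q ^ (2 * n + 1)) (q ^ 2) * qPochInf (q ^ (n + 1)) q)) := by ring
      _ = (qPoch q (q ^ 2) n * qPoch q q n * r2) *
          (qPoch z q n * qPoch zInv q n * q ^ e n *
            (qPochInf (q ^ (2 * n + 1)) (q ^ 2) * qPochInf (q ^ (n + 1)) q)) := by rw [h1, h2]
      _ = _ := by ring
  · exact summable_of_dvd fun k => ((hd k).mul_right _).mul_right _
  · exact summable_of_dvd fun k => ((hd k).mul_right _).mul_right _

end SptCrank

/-! Since `(q; q²)_∞ (q²; q²)_∞ = (q; q)_∞`, the series `(q²; q²)_∞ S(z, q)` is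
`∑_{n ≥ 1} q ^ n T_n β_n`, where `T_n = (q; q)_∞² / ((z q ^ n; q)_∞ (z⁻¹ q ^ n; q)_∞)` and `β` is
the second sequence of Slater's Bailey pair C(1) or C(5). Bailey's lemma turns this sum into a
combination of the partial fractions `q ^ r / ((1 - z q ^ r) (1 - z⁻¹ q ^ r))`, in which
subtracting the unit Bailey pair has cancelled the term `r = 0`. Each of them occurs with a factor
`1 + q ^ r`, and the product has as its coefficient of `z ^ m` a geometric series in `q`, so that
the coefficient of `z ^ m` in `(q²; q²)_∞ S(z, q)` is a signed sum of geometric series. Taking the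
terms of index `2 l + 1`, `4 l + 2` and `4 l + 4` together, the negative ones are subtracted from
positive ones with the same ratio and congruent exponents, which leaves finite sums of powers of
`q`. For C(5) these are nonnegative; for C(1) some negative powers remain, and the factor
`1 / (1 - q²)` of `1 / (q²; q²)_∞` compensates them by smaller positive powers of the same parity.
-/

namespace SptCrank

open Finset PowerSeries
open scoped LaurentPolynomial PowerSeries.WithPiTopology Topology

section BaileyPairs

variable {R : Type*} [CommRing R]

/-- `I n = 1 / ∏_{j < n} a j`, stated without division so as to make sense in any commutative
ring. -/
def IsInvProd (a I : ℕ → R) : Prop :=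
  ∀ n, (∏ j ∈ range n, a j) * I n = 1

namespace IsInvProd

variable {a I : ℕ → R}

theorem zero (h : IsInvProd a I) : I 0 = 1 := by simpa using h 0

theorem isUnit (h : IsInvProd a I) (n : ℕ) : IsUnit (a n) := by
  refine IsUnit.of_mul_eq_one ((∏ j ∈ range n, a j) * I (n + 1)) ?_
  rw [← h (n + 1), prod_range_succ]
  ring

theorem eq_mul_succ (h : IsInvProd a I) (n : ℕ) : I n = a n * I (n + 1) := by
  have hsucc := h (n + 1)
  rw [prod_range_succ] at hsucc
  linear_combination a n * I (n + 1) * h n - I n * hsucc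

end IsInvProd

/-- The kernel `1 / ((x; x)_{n - r} (x; x)_{n + r})` of Bailey pairs relative to `1`, where
`I n` stands for `1 / (x; x)_n`. It vanishes for `r > n`. -/
def baileyKernel (I : ℕ → R) (n r : ℕ) : R :=
  if r ≤ n then I (n - r) * I (n + r) else 0

/-- `(α, β)` is a Bailey pair relative to `1`, where `I n` stands for `1 / (x; x)_n`. -/
def IsBaileyPair (I α β : ℕ → R) : Prop :=
  ∀ n, β n = ∑ r ∈ range (n + 1), α r * baileyKernel I n r

theorem baileyKernel_of_lt (I : ℕ → R) {n r : ℕ} (h : n < r) : baileyKernel I n r = 0 :=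
  if_neg h.not_ge

theorem baileyKernel_add_left (I : ℕ → R) (k r : ℕ) :
    baileyKernel I (k + r) r = I k * I (k + r + r) := by
  simp [baileyKernel]

theorem sum_range_mul_baileyKernel (I α : ℕ → R) {n N : ℕ} (h : n < N) :
    ∑ r ∈ range N, α r * baileyKernel I n r = ∑ r ∈ range (n + 1), α r * baileyKernel I n r :=
  (sum_subset (range_subset_range.mpr h) fun r _ hr => by
    rw [baileyKernel_of_lt I (by simpa [Nat.lt_succ_iff] using hr), mul_zero]).symm

theorem IsBaileyPair.sub {I α β α' β' : ℕ → R} (h : IsBaileyPair I α β)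
    (h' : IsBaileyPair I α' β') : IsBaileyPair I (α - α') (β - β') := fun n => by
  simp only [Pi.sub_apply, h n, h' n, sub_mul, sum_sub_distrib]

theorem IsBaileyPair.of_recurrence {I α β c d : ℕ → R} (hzero : β 0 = α 0 * baileyKernel I 0 0)
    (hunit : ∀ n, IsUnit (c n)) (hβ : ∀ n, c n * β (n + 1) = d n * β n)
    (hα : ∀ n, ∃ N > n + 1, ∑ r ∈ range N,
      α r * (c n * baileyKernel I (n + 1) r - d n * baileyKernel I n r) = 0) :
    IsBaileyPair I α β := by
  intro n
  induction n with
  | zero => simpa using hzero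
  | succ n ih =>
    obtain ⟨N, hN, hsum⟩ := hα n
    simp only [mul_sub, mul_left_comm (α _), sum_sub_distrib, ← mul_sum] at hsum
    rw [sum_range_mul_baileyKernel I α hN, sum_range_mul_baileyKernel I α (by omega : n < N),
      ← ih, ← hβ, ← mul_sub] at hsum
    exact (sub_eq_zero.mp ((hunit n).mul_right_eq_zero.mp hsum)).symm

section Kernel

variable {x : R} {I : ℕ → R}

theorem baileyKernel_eq_mul_succ_succ (hI : IsInvProd (fun j => 1 - x ^ (j + 1)) I) (n r : ℕ) :
    baileyKernel I n r =
      (1 - x ^ (n + r + 1)) * (1 - x ^ (n + r + 2)) * baileyKernel I (n + 1) (r + 1) := by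
  rcases lt_or_ge n r with h | h
  · rw [baileyKernel_of_lt I h, baileyKernel_of_lt I (by omega), mul_zero]
  obtain ⟨k, rfl⟩ := Nat.exists_eq_add_of_le' h
  rw [baileyKernel_add_left, add_assoc k r 1, baileyKernel_add_left, hI.eq_mul_succ (k + r + r),
    hI.eq_mul_succ (k + r + r + 1), show k + (r + 1) + (r + 1) = k + r + r + 1 + 1 by ring]
  ring

theorem baileyKernel_eq_mul_succ_left (hI : IsInvProd (fun j => 1 - x ^ (j + 1)) I) (n r : ℕ) :
    baileyKernel I n r =
      (1 - x ^ (n + 1 - r)) * (1 - x ^ (n + 1 + r)) * baileyKernel I (n + 1) r := by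
  rcases lt_trichotomy r (n + 1) with h | rfl | h
  · obtain ⟨k, rfl⟩ := Nat.exists_eq_add_of_le' (Nat.lt_succ_iff.mp h)
    rw [show k + r + 1 = k + 1 + r by ring, baileyKernel_add_left, baileyKernel_add_left,
      Nat.add_sub_cancel, hI.eq_mul_succ k, hI.eq_mul_succ (k + r + r),
      show k + 1 + r + r = k + r + r + 1 by ring]
    ring
  · simp [baileyKernel_of_lt]
  · rw [baileyKernel_of_lt I h, baileyKernel_of_lt I (by omega), mul_zero]

theorem one_sub_pow_mul_baileyKernel (hI : IsInvProd (fun j => 1 - x ^ (j + 1)) I) (n r : ℕ) :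
    (1 - x ^ (n - r)) * baileyKernel I n r =
      (1 - x ^ (n + r + 1)) * baileyKernel I n (r + 1) := by
  rw [baileyKernel_eq_mul_succ_left hI n (r + 1), baileyKernel_eq_mul_succ_succ hI n r,
    Nat.add_sub_add_right]
  ring

theorem baileyKernel_succ_right (hI : IsInvProd (fun j => 1 - x ^ (j + 1)) I) (n r : ℕ) :
    baileyKernel I n (r + 1) =
      (1 - x ^ (n - r)) * (1 - x ^ (n + 1 - r)) * baileyKernel I (n + 1) r := by
  have hstep := one_sub_pow_mul_baileyKernel hI (n + 1) r
  rw [baileyKernel_eq_mul_succ_left hI n (r + 1), Nat.add_sub_add_right]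
  linear_combination (-(1 - x ^ (n - r))) * hstep

end Kernel

/-- The sequence `α_0 = 1`, `α_s = a_s (1 + x ^ s)`: in all the Bailey pairs below `α_s` combines
the terms at `s` and `-s` of a bilateral sequence, whose values for positive `s` are `a_s`. -/
def foldedAlpha (x : R) (a : ℕ → R) (s : ℕ) : R :=
  if s = 0 then 1 else a s * (1 + x ^ s)

/-- The coefficients `(-1) ^ s x ^ (s (s - 1) / 2)` of the unit Bailey pair. -/
def unitCoeff (x : R) (s : ℕ) : R :=
  (-1) ^ s * x ^ s.choose 2

/-- The coefficients of Slater's Bailey pair C(1), supported on even `s`. -/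
def slaterC1Coeff (x : R) (s : ℕ) : R :=
  if Even s then (-1) ^ (s / 2) * x ^ (s / 2 * (3 * (s / 2) - 1)) else 0

/-- The coefficients of Slater's Bailey pair C(5), supported on even `s`. -/
def slaterC5Coeff (x : R) (s : ℕ) : R :=
  if Even s then (-1) ^ (s / 2) * x ^ (s / 2 * (s / 2 - 1)) else 0

theorem foldedAlpha_zero (x : R) (a : ℕ → R) : foldedAlpha x a 0 = 1 := if_pos rfl

theorem foldedAlpha_succ (x : R) (a : ℕ → R) (s : ℕ) :
    foldedAlpha x a (s + 1) = a (s + 1) * (1 + x ^ (s + 1)) := if_neg s.succ_ne_zero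

theorem slaterC1Coeff_two_mul_succ (x : R) (t : ℕ) :
    slaterC1Coeff x (2 * t + 2) = (-1) ^ (t + 1) * x ^ ((t + 1) * (3 * t + 2)) := by
  rw [slaterC1Coeff, if_pos ⟨t + 1, by ring⟩, show (2 * t + 2) / 2 = t + 1 by omega,
    show 3 * (t + 1) - 1 = 3 * t + 2 by omega]

theorem slaterC1Coeff_two_mul_add_one (x : R) (t : ℕ) : slaterC1Coeff x (2 * t + 1) = 0 :=
  if_neg (by simp)

theorem slaterC5Coeff_two_mul_succ (x : R) (t : ℕ) :
    slaterC5Coeff x (2 * t + 2) = (-1) ^ (t + 1) * x ^ ((t + 1) * t) := by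
  rw [slaterC5Coeff, if_pos ⟨t + 1, by ring⟩, show (2 * t + 2) / 2 = t + 1 by omega,
    Nat.add_sub_cancel]

theorem slaterC5Coeff_two_mul_add_one (x : R) (t : ℕ) : slaterC5Coeff x (2 * t + 1) = 0 :=
  if_neg (by simp)

section Pairs

variable {x : R} {I O : ℕ → R}

theorem unit_partial_sum (hI : IsInvProd (fun j => 1 - x ^ (j + 1)) I) (n N : ℕ) :
    (1 - x ^ n) * ∑ s ∈ range (N + 1), foldedAlpha x (unitCoeff x) s * baileyKernel I n s =
      (-1) ^ N * x ^ (N + 1).choose 2 * ((1 - x ^ (n - N)) * baileyKernel I n N) := by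
  induction N with
  | zero => simp [foldedAlpha]
  | succ N ih =>
    rw [sum_range_succ, mul_add, ih, one_sub_pow_mul_baileyKernel hI, foldedAlpha_succ, unitCoeff,
      Nat.choose_succ_succ' (N + 1) 1, Nat.choose_one_right]
    rcases lt_or_ge n (N + 1) with h | h
    · simp [baileyKernel_of_lt I h]
    obtain ⟨k, rfl⟩ := Nat.exists_eq_add_of_le' h
    rw [Nat.add_sub_cancel]
    ring

theorem isBaileyPair_unit (hI : IsInvProd (fun j => 1 - x ^ (j + 1)) I) :
    IsBaileyPair I (foldedAlpha x (unitCoeff x)) (Pi.single 0 1) := by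
  rintro (_ | n)
  · simp [foldedAlpha, baileyKernel, hI.zero]
  · have hsum := unit_partial_sum hI (n + 1) (n + 1)
    rw [Nat.sub_self, pow_zero, sub_self, zero_mul, mul_zero] at hsum
    rw [Pi.single_eq_of_ne n.succ_ne_zero, (hI.isUnit n).mul_right_eq_zero.mp hsum]

theorem foldedAlpha_partial_sum_of_odd_eq_zero {a E : ℕ → R} {d : R} {n : ℕ}
    (hI : IsInvProd (fun j => 1 - x ^ (j + 1)) I) (hodd : ∀ t, a (2 * t + 1) = 0)
    (hzero : 1 - x ^ (2 * n + 1) - d * (1 - x ^ (n + 1)) = E 0 * (1 - x ^ n))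
    (hsucc : ∀ N k, n = k + (2 * N + 1) →
      a (2 * N + 2) * (1 + x ^ (2 * N + 2)) * ((1 - x ^ (n + 1)) * (1 - x ^ (2 * n + 1)) -
          d * ((1 - x ^ k) * (1 - x ^ (n + 2 * N + 3)))) =
        E (N + 1) * ((1 - x ^ (k - 1)) * (1 - x ^ k)) -
          E N * ((1 - x ^ (n + 2 * N + 2)) * (1 - x ^ (n + 2 * N + 3)))) (N : ℕ) :
    ∑ s ∈ range (2 * N + 2), foldedAlpha x a s *
        ((1 - x ^ (n + 1)) * (1 - x ^ (2 * n + 1)) * baileyKernel I (n + 1) s -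
          d * baileyKernel I n s) =
      E N * baileyKernel I n (2 * N + 1) := by
  induction N with
  | zero =>
    have hone : a (0 + 1) = 0 := hodd 0
    simp only [mul_zero, zero_add 2, sum_range_succ, sum_range_zero, zero_add (_ * _),
      foldedAlpha_zero, foldedAlpha_succ, hone, baileyKernel_eq_mul_succ_left hI n 0,
      baileyKernel_succ_right hI n 0, Nat.sub_zero]
    linear_combination (1 - x ^ (n + 1)) * baileyKernel I (n + 1) 0 * hzero
  | succ N ih =>
    rw [show 2 * (N + 1) + 2 = 2 * N + 2 + 1 + 1 by ring, sum_range_succ, sum_range_succ, ih,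
      show 2 * N + 2 + 1 = 2 * (N + 1) + 1 by ring, foldedAlpha_succ _ _ (2 * N + 1),
      foldedAlpha_succ, hodd, mul_add_one 2 N, baileyKernel_eq_mul_succ_succ hI n (2 * N + 1),
      baileyKernel_eq_mul_succ_left hI n (2 * N + 2),
      baileyKernel_succ_right hI n (2 * N + 2)]
    rcases lt_or_ge n (2 * N + 1) with h | h
    · simp [baileyKernel_of_lt I (show n + 1 < 2 * N + 2 by omega)]
    obtain ⟨k, hk⟩ := Nat.exists_eq_add_of_le' h
    rw [show n + 1 - (2 * N + 2) = k by omega, show n - (2 * N + 2) = k - 1 by omega]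
    linear_combination baileyKernel I (n + 1) (2 * N + 2) * hsucc N k hk

theorem isBaileyPair_slaterC1 (hI : IsInvProd (fun j => 1 - x ^ (j + 1)) I)
    (hO : IsInvProd (fun j => 1 - x ^ (2 * j + 1)) O) :
    IsBaileyPair I (foldedAlpha x (slaterC1Coeff x)) fun n => O n * I n := by
  refine .of_recurrence (c := fun n => (1 - x ^ (n + 1)) * (1 - x ^ (2 * n + 1)))
    (d := fun _ => 1) ?_ (fun n => (hI.isUnit n).mul (hO.isUnit n)) (fun n => ?_)
    fun n => ⟨2 * n + 2, by omega, ?_⟩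
  · simp [foldedAlpha_zero, baileyKernel, hI.zero, hO.zero]
  · rw [hI.eq_mul_succ n, hO.eq_mul_succ n]
    ring
  · refine (foldedAlpha_partial_sum_of_odd_eq_zero
      (E := fun N => (-1) ^ N * x ^ (n + 1 + 3 * (N * (N + 1)))) hI
      (slaterC1Coeff_two_mul_add_one x) (by ring) ?_ n).trans ?_
    · rintro N (_ | k) rfl
      all_goals
        simp only [slaterC1Coeff_two_mul_succ, pow_zero, Nat.add_sub_cancel, sub_self]
        ring
    · rw [baileyKernel_of_lt I (by omega), mul_zero]

theorem isBaileyPair_slaterC5 (hI : IsInvProd (fun j => 1 - x ^ (j + 1)) I)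
    (hO : IsInvProd (fun j => 1 - x ^ (2 * j + 1)) O) :
    IsBaileyPair I (foldedAlpha x (slaterC5Coeff x)) fun n => x ^ n.choose 2 * (O n * I n) := by
  refine .of_recurrence (c := fun n => (1 - x ^ (n + 1)) * (1 - x ^ (2 * n + 1)))
    (d := fun n => x ^ n) ?_ (fun n => (hI.isUnit n).mul (hO.isUnit n)) (fun n => ?_)
    fun n => ⟨2 * n + 2, by omega, ?_⟩
  · simp [foldedAlpha_zero, baileyKernel, hI.zero, hO.zero]
  · rw [hI.eq_mul_succ n, hO.eq_mul_succ n, Nat.choose_succ_succ' n 1, Nat.choose_one_right]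
    ring
  · refine (foldedAlpha_partial_sum_of_odd_eq_zero
      (E := fun N => (-1) ^ N * x ^ (N * (N + 1))) hI
      (slaterC5Coeff_two_mul_add_one x) (by ring) ?_ n).trans ?_
    · rintro N (_ | k) rfl
      all_goals
        simp only [slaterC5Coeff_two_mul_succ, pow_zero, Nat.add_sub_cancel, sub_self]
        ring
    · rw [baileyKernel_of_lt I (by omega), mul_zero]

end Pairs

theorem conjugate_partial_sum {x y w : R} {I T : ℕ → R} (hyw : y * w = 1)
    (hI : IsInvProd (fun j => 1 - x ^ (j + 1)) I)
    (hT : ∀ n, T (n + 1) = (1 - y * x ^ (n + 1)) * (1 - w * x ^ (n + 1)) * T n)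
    {r : ℕ} (hr : r ≠ 0) (N : ℕ) :
    (1 - y * x ^ r) * (1 - w * x ^ r) *
        ∑ n ∈ range N, x ^ (n + 1) * T n * baileyKernel I (n + 1) r =
      x ^ r * (T N * baileyKernel I N r) := by
  induction N with
  | zero => simp [baileyKernel_of_lt I (Nat.pos_of_ne_zero hr)]
  | succ N ih =>
    rw [sum_range_succ, mul_add, ih, hT N, baileyKernel_eq_mul_succ_left hI N r]
    rcases lt_or_ge (N + 1) r with h | h
    · simp [baileyKernel_of_lt I h]
    obtain ⟨k, hk⟩ := Nat.exists_eq_add_of_le' h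
    rw [hk, Nat.add_sub_cancel]
    linear_combination x ^ (k + r) * (x ^ (2 * r) - x ^ r * x ^ (k + r)) * T N *
      baileyKernel I (k + r) r * hyw

end BaileyPairs

theorem hasSum_tsum_comm {ι κ M : Type*} [AddCommMonoid M] [TopologicalSpace M] [T3Space M]
    [ContinuousAdd M] {F : ι × κ → M} (hF : Summable F) {f : ι → M} {g : κ → M}
    (hf : ∀ i, HasSum (fun k => F (i, k)) (f i)) (hg : ∀ k, HasSum (fun i => F (i, k)) (g k)) :
    HasSum f (∑' k, g k) := by
  have hswap : ∑' p : κ × ι, F p.swap = ∑' p, F p := (Equiv.prodComm κ ι).tsum_eq F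
  rw [(hF.prod_symm.hasSum.prod_fiberwise hg).tsum_eq, hswap]
  exact hF.hasSum.prod_fiberwise hf

section FormalConvergence

variable {R : Type*} [CommRing R]

/-- The power series congruent to `1` modulo `X ^ N`. -/
def congruentOne (R : Type*) [CommRing R] (N : ℕ) : Submonoid R⟦X⟧ where
  carrier := {f | X ^ N ∣ f - 1}
  one_mem' := by simp
  mul_mem' {f g} hf hg := by
    change X ^ N ∣ f * g - 1
    rw [show f * g - 1 = (f - 1) * g + (g - 1) by ring]
    exact dvd_add (dvd_mul_of_dvd_left hf g) hg

theorem mem_congruentOne {N : ℕ} {f : R⟦X⟧} : f ∈ congruentOne R N ↔ X ^ N ∣ f - 1 :=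
  Iff.rfl

theorem one_sub_mem_congruentOne {N : ℕ} {f : R⟦X⟧} (hf : X ^ N ∣ f) :
    1 - f ∈ congruentOne R N := by
  simpa [mem_congruentOne] using hf

theorem mem_congruentOne_of_mul_eq_one {N : ℕ} {f g : R⟦X⟧} (hf : f ∈ congruentOne R N)
    (hfg : f * g = 1) : g ∈ congruentOne R N := by
  have hg : g - 1 = -((f - 1) * g) := by linear_combination hfg
  exact mem_congruentOne.mpr (hg.symm ▸ dvd_neg.mpr (hf.mul_right g))

variable [TopologicalSpace R]

theorem isClosed_congruentOne [T1Space R] (N : ℕ) : IsClosed (congruentOne R N : Set R⟦X⟧) := by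
  have hset : (congruentOne R N : Set R⟦X⟧) =
      ⋂ i : ℕ, ⋂ _ : i < N, coeff i ⁻¹' {coeff i (1 : R⟦X⟧)} := by
    ext f
    simp [mem_congruentOne, X_pow_dvd_iff, sub_eq_zero]
  rw [hset]
  exact isClosed_iInter fun i => isClosed_iInter fun _ =>
    isClosed_singleton.preimage (WithPiTopology.continuous_coeff R i)

theorem tendsto_of_X_pow_dvd_sub {f : ℕ → R⟦X⟧} {g : R⟦X⟧} (h : ∀ N, X ^ N ∣ f N - g) :
    Filter.Tendsto f Filter.atTop (𝓝 g) := by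
  refine (WithPiTopology.tendsto_iff_coeff_tendsto R f Filter.atTop g).mpr fun d =>
    tendsto_const_nhds.congr' ?_
  filter_upwards [Filter.eventually_gt_atTop d] with N hN
  have hd := X_pow_dvd_iff.mp (h N) d hN
  rw [map_sub, sub_eq_zero] at hd
  exact hd.symm

theorem summable_of_finite_not_X_pow_dvd {ι : Type*} {f : ι → R⟦X⟧}
    (h : ∀ N, {i | ¬ X ^ N ∣ f i}.Finite) : Summable f := by
  refine (WithPiTopology.summable_iff_summable_coeff R).mpr fun d =>
    summable_of_hasFiniteSupport ((h (d + 1)).subset fun i hi hdvd => hi ?_)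
  exact X_pow_dvd_iff.mp hdvd d d.lt_succ_self

end FormalConvergence

section ConjugatePair

theorem qPochInf_mem_congruentOne {a : ZQ} (p : ZQ) {N : ℕ} (ha : q ^ N ∣ a) :
    qPochInf a p ∈ congruentOne ℤ[T;T⁻¹] N :=
  tprod_mem (isClosed_congruentOne N) fun j => one_sub_mem_congruentOne (ha.mul_right (p ^ j))

theorem qPochInf_eq_one_sub_mul (a : ZQ) {p : ZQ} (hp : q ∣ p) :
    qPochInf a p = (1 - a) * qPochInf (a * p) p := by
  rw [← qPoch_mul_qPochInf a hp 1]
  simp [qPoch]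

theorem qPochInf_q_sq_mul : qPochInf q (q ^ 2) * qPochInf (q ^ 2) (q ^ 2) = qPochInf q q := by
  have hsq : q ∣ q ^ 2 := dvd_pow_self q two_ne_zero
  have heven (j : ℕ) : 1 - q * (q ^ 2) ^ j = 1 - q * q ^ (2 * j) := by rw [pow_mul]
  have hodd (j : ℕ) : 1 - q ^ 2 * (q ^ 2) ^ j = 1 - q * q ^ (2 * j + 1) := by ring
  have hm := multipliable_qPoch q hsq
  have hm' := multipliable_qPoch (q ^ 2) hsq
  simp only [qPochInf]
  simp only [heven, hodd] at hm hm' ⊢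
  exact tprod_even_mul_odd (f := fun j => 1 - q * q ^ j) hm hm'

/-- `1 / (q; q)_n`. -/
noncomputable def invQFactorial (n : ℕ) : ZQ := recip (qPoch q q n)

/-- `1 / (q; q²)_n`. -/
noncomputable def invOddQFactorial (n : ℕ) : ZQ := recip (qPoch q (q ^ 2) n)

theorem isInvProd_invQFactorial : IsInvProd (fun j => 1 - q ^ (j + 1)) invQFactorial := fun n => by
  simpa only [qPoch, pow_succ', invQFactorial] using mul_recip (constantCoeff_qPoch q dvd_rfl n)

theorem isInvProd_invOddQFactorial :
    IsInvProd (fun j => 1 - q ^ (2 * j + 1)) invOddQFactorial := fun n => by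
  have hpow (j : ℕ) : q ^ (2 * j + 1) = q * (q ^ 2) ^ j := by ring
  simp only [hpow]
  exact mul_recip (constantCoeff_qPoch (q ^ 2) dvd_rfl n)

theorem qPochInf_mul_invQFactorial (n : ℕ) :
    qPochInf q q * invQFactorial n = qPochInf (q ^ (n + 1)) q := by
  rw [← qPoch_mul_qPochInf q dvd_rfl n, pow_succ', invQFactorial]
  linear_combination qPochInf (q * q ^ n) q * mul_recip (constantCoeff_qPoch q dvd_rfl n)

theorem qPochInf_mul_invOddQFactorial (n : ℕ) :
    qPochInf q (q ^ 2) * invOddQFactorial n = qPochInf (q ^ (2 * n + 1)) (q ^ 2) := by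
  rw [← qPoch_mul_qPochInf q (dvd_pow_self q two_ne_zero) n,
    show q ^ (2 * n + 1) = q * (q ^ 2) ^ n by ring, invOddQFactorial]
  linear_combination qPochInf (q * (q ^ 2) ^ n) (q ^ 2) *
    mul_recip (constantCoeff_qPoch (q ^ 2) dvd_rfl n)

/-- `(z q ^ (n + 1); q)_∞ (z⁻¹ q ^ (n + 1); q)_∞`, the denominator of the `n`-th term of
`sptSeries`. -/
noncomputable def crankDenom (n : ℕ) : ZQ :=
  qPochInf (z * q ^ (n + 1)) q * qPochInf (zInv * q ^ (n + 1)) q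

/-- `(q; q)_∞ ^ 2 / ((z q ^ (n + 1); q)_∞ (z⁻¹ q ^ (n + 1); q)_∞)`, which up to `q ^ (n + 1)` is the
weight of `β_{n + 1}` in `(q²; q²)_∞ S(z, q)`. -/
noncomputable def crankTail (n : ℕ) : ZQ :=
  qPochInf q q ^ 2 * recip (crankDenom n)

/-- `1 / ((1 - z q ^ r) (1 - z⁻¹ q ^ r))`, meaningful for `r ≥ 1`. -/
noncomputable def poleFactor (r : ℕ) : ZQ :=
  recip ((1 - z * q ^ r) * (1 - zInv * q ^ r))

theorem z_mul_zInv : z * zInv = 1 := by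
  rw [z, zInv, ← map_mul, ← LaurentPolynomial.T_add, add_neg_cancel, LaurentPolynomial.T_zero,
    map_one]

theorem mul_poleFactor {r : ℕ} (hr : r ≠ 0) :
    (1 - z * q ^ r) * (1 - zInv * q ^ r) * poleFactor r = 1 :=
  mul_recip (by simp [q, hr])

theorem crankDenom_mul_recip (n : ℕ) : crankDenom n * recip (crankDenom n) = 1 := by
  have hq : q ∣ q ^ (n + 1) := dvd_pow_self q n.succ_ne_zero
  refine mul_recip ?_
  rw [crankDenom, map_mul, constantCoeff_qPochInf (hq.mul_left z) dvd_rfl,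
    constantCoeff_qPochInf (hq.mul_left zInv) dvd_rfl, one_mul]

theorem crankDenom_eq_mul_succ (n : ℕ) :
    crankDenom n = (1 - z * q ^ (n + 1)) * (1 - zInv * q ^ (n + 1)) * crankDenom (n + 1) := by
  rw [crankDenom, crankDenom, qPochInf_eq_one_sub_mul (z * q ^ (n + 1)) dvd_rfl,
    qPochInf_eq_one_sub_mul (zInv * q ^ (n + 1)) dvd_rfl, mul_assoc z, mul_assoc zInv, ← pow_succ]
  ring

theorem crankTail_succ (n : ℕ) :
    crankTail (n + 1) = (1 - z * q ^ (n + 1)) * (1 - zInv * q ^ (n + 1)) * crankTail n := by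
  rw [crankTail, crankTail]
  linear_combination qPochInf q q ^ 2 *
    ((1 - z * q ^ (n + 1)) * (1 - zInv * q ^ (n + 1)) * recip (crankDenom n) *
        crankDenom_mul_recip (n + 1) -
      recip (crankDenom (n + 1)) * crankDenom_mul_recip n +
      recip (crankDenom n) * recip (crankDenom (n + 1)) * crankDenom_eq_mul_succ n)

theorem crankTail_mul_baileyKernel_mem (n r : ℕ) :
    crankTail (n + r) * baileyKernel invQFactorial (n + r) r ∈ congruentOne ℤ[T;T⁻¹] n := by
  have hprod : crankTail (n + r) * baileyKernel invQFactorial (n + r) r =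
      qPochInf (q ^ (n + 1)) q * qPochInf (q ^ (n + r + r + 1)) q *
        recip (crankDenom (n + r)) := by
    rw [baileyKernel_add_left, ← qPochInf_mul_invQFactorial, ← qPochInf_mul_invQFactorial,
      crankTail]
    ring
  have hmem {m : ℕ} (a : ZQ) (h : n ≤ m) :
      qPochInf (a * q ^ m) q ∈ congruentOne ℤ[T;T⁻¹] n :=
    qPochInf_mem_congruentOne q ((pow_dvd_pow q h).mul_left a)
  rw [hprod]
  refine mul_mem (mul_mem ?_ ?_)
    (mem_congruentOne_of_mul_eq_one ?_ (crankDenom_mul_recip (n + r)))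
  · simpa using hmem 1 n.le_succ
  · simpa using hmem 1 (by omega : n ≤ n + r + r + 1)
  · exact mul_mem (hmem z (by omega)) (hmem zInv (by omega))

theorem hasSum_conjugate {r : ℕ} (hr : r ≠ 0) :
    HasSum (fun n => q ^ (n + 1) * crankTail n * baileyKernel invQFactorial (n + 1) r)
      (q ^ r * poleFactor r) := by
  have hsummable : Summable
      fun n => q ^ (n + 1) * crankTail n * baileyKernel invQFactorial (n + 1) r :=
    summable_of_dvd fun n => ((pow_dvd_pow q n.le_succ).mul_right _).mul_right _
  have hpartial (N : ℕ) :
      ∑ n ∈ range N, q ^ (n + 1) * crankTail n * baileyKernel invQFactorial (n + 1) r =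
        q ^ r * poleFactor r * (crankTail N * baileyKernel invQFactorial N r) := by
    have htelescope := conjugate_partial_sum z_mul_zInv isInvProd_invQFactorial crankTail_succ hr N
    linear_combination poleFactor r * htelescope - (∑ n ∈ range N, q ^ (n + 1) * crankTail n *
      baileyKernel invQFactorial (n + 1) r) * mul_poleFactor hr
  have hlim : Filter.Tendsto (fun N => crankTail N * baileyKernel invQFactorial N r)
      Filter.atTop (𝓝 1) :=
    (Filter.tendsto_add_atTop_iff_nat r).mp
      (tendsto_of_X_pow_dvd_sub fun N => crankTail_mul_baileyKernel_mem N r)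
  rw [hsummable.hasSum_iff_tendsto_nat]
  simp only [hpartial]
  simpa using hlim.const_mul (q ^ r * poleFactor r)

theorem summable_bailey (α : ℕ → ZQ) : Summable fun p : ℕ × ℕ => α (p.1 + 1) *
    (q ^ (p.2 + 1) * crankTail p.2 * baileyKernel invQFactorial (p.2 + 1) (p.1 + 1)) := by
  refine summable_of_finite_not_X_pow_dvd fun N =>
    ((Set.finite_Iio N).prod (Set.finite_Iio N)).subset ?_
  rintro ⟨r, n⟩ hdvd
  by_contra hmem
  refine hdvd ?_
  rcases lt_or_ge n N with hn | hn
  · have hr : ¬ r < N := fun hr => hmem ⟨hr, hn⟩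
    simp [baileyKernel_of_lt invQFactorial (by omega : n + 1 < r + 1)]
  · exact (((pow_dvd_pow q (by omega)).mul_right _).mul_right _).mul_left _

/-- Bailey's lemma for the conjugate pair `hasSum_conjugate`. -/
theorem IsBaileyPair.hasSum_poleFactor {α β : ℕ → ZQ} (h : IsBaileyPair invQFactorial α β)
    (hzero : α 0 = 0) :
    HasSum (fun r => α (r + 1) * (q ^ (r + 1) * poleFactor (r + 1)))
      (∑' n, q ^ (n + 1) * crankTail n * β (n + 1)) := by
  refine hasSum_tsum_comm (summable_bailey α)
    (fun r => (hasSum_conjugate r.succ_ne_zero).mul_left (α (r + 1))) fun n => ?_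
  rw [h, sum_range_succ', hzero, zero_mul, add_zero, mul_sum]
  simp only [mul_left_comm _ (α _)]
  refine hasSum_sum_of_ne_finset_zero fun r hr => ?_
  rw [baileyKernel_of_lt invQFactorial (by simpa using hr : n + 1 < r + 1), mul_zero, mul_zero]

theorem qPochInf_q_sq_mul_sptNumerator (n : ℕ) :
    qPochInf (q ^ 2) (q ^ 2) * (qPochInf (q ^ (2 * n + 1)) (q ^ 2) * qPochInf (q ^ (n + 1)) q) =
      qPochInf q q ^ 2 * (invOddQFactorial n * invQFactorial n) := by
  rw [← qPochInf_mul_invOddQFactorial, ← qPochInf_mul_invQFactorial]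
  linear_combination invOddQFactorial n * invQFactorial n * qPochInf q q * qPochInf_q_sq_mul

/-- Subtracting the unit pair does not change `β_n` for `n ≥ 1` and cancels `α_0`, whose
contribution would be the meaningless `poleFactor 0`. -/
theorem IsBaileyPair.hasSum_sptSeries {a : ℕ → ZQ} {b : ℕ → ℕ}
    (h : IsBaileyPair invQFactorial (foldedAlpha q a)
      fun n => q ^ b n * (invOddQFactorial n * invQFactorial n)) :
    HasSum (fun r => (a (r + 1) - unitCoeff q (r + 1)) * (1 + q ^ (r + 1)) *
        (q ^ (r + 1) * poleFactor (r + 1)))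
      (qPochInf (q ^ 2) (q ^ 2) * sptSeries fun n => n + b n) := by
  have hsum := (h.sub (isBaileyPair_unit isInvProd_invQFactorial)).hasSum_poleFactor
    (by simp [foldedAlpha_zero])
  convert hsum using 1
  · funext r
    simp only [Pi.sub_apply, foldedAlpha_succ, sub_mul]
  · have hd (k : ℕ) : q ^ k ∣ q ^ (k + 1 + b (k + 1)) := pow_dvd_pow q (by omega)
    rw [sptSeries, ← (summable_of_dvd fun k => ((hd k).mul_right _).mul_right _).tsum_mul_left]
    refine tsum_congr fun k => ?_
    rw [Pi.sub_apply, Pi.single_eq_of_ne k.succ_ne_zero, crankTail, ← crankDenom]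
    linear_combination q ^ (k + 1 + b (k + 1)) * recip (crankDenom k) *
      qPochInf_q_sq_mul_sptNumerator (k + 1)

end ConjugatePair

section ZCoefficients

theorem continuous_of_coeff_eq {A B : Type*} [Semiring A] [Semiring B] [TopologicalSpace A]
    [TopologicalSpace B] [DiscreteTopology A] {F : A⟦X⟧ → B⟦X⟧} (φ : A → B)
    (h : ∀ f n, coeff n (F f) = φ (coeff n f)) : Continuous F := by
  refine continuous_iff_continuousAt.mpr fun f =>
    (WithPiTopology.tendsto_iff_coeff_tendsto B F (𝓝 f) (F f)).mpr fun n => ?_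
  simp only [h]
  exact (continuous_of_discreteTopology.comp (WithPiTopology.continuous_coeff A n)).tendsto f

/-- The coefficient of `z ^ m`, as a power series in `q`. -/
noncomputable def zCoeff (m : ℤ) : ZQ →+ ℤ⟦X⟧ where
  toFun f := PowerSeries.mk fun n => (coeff n f).coeff m
  map_zero' := by ext; simp
  map_add' f g := by ext; simp

/-- The inclusion of `ℤ⟦q⟧` into `ℤ[z, z⁻¹]⟦q⟧`. -/
noncomputable def ofInt : ℤ⟦X⟧ →+* ZQ := PowerSeries.map LaurentPolynomial.C

theorem coeff_zCoeff (m : ℤ) (f : ZQ) (n : ℕ) :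
    coeff n (zCoeff m f) = (coeff n f).coeff m := by
  simp [zCoeff]

theorem continuous_zCoeff (m : ℤ) : Continuous (zCoeff m) :=
  continuous_of_coeff_eq (fun a => a.coeff m) (coeff_zCoeff m)

theorem continuous_ofInt : Continuous ofInt :=
  continuous_of_coeff_eq LaurentPolynomial.C fun f n => coeff_map LaurentPolynomial.C n f

theorem ofInt_X : ofInt X = q := map_X _

theorem zCoeff_ofInt_mul (m : ℤ) (g : ℤ⟦X⟧) (f : ZQ) :
    zCoeff m (ofInt g * f) = g * zCoeff m f := by
  ext n
  rw [coeff_zCoeff, coeff_mul, coeff_mul, AddMonoidAlgebra.coeff_sum, Finsupp.finsetSum_apply]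
  refine sum_congr rfl fun p _ => ?_
  rw [coeff_zCoeff, ofInt, coeff_map, ← LaurentPolynomial.smul_eq_C_mul,
    AddMonoidAlgebra.coeff_smul, Finsupp.smul_apply, smul_eq_mul]

theorem zCoeff_C_T_mul_q_pow (m u : ℤ) (n : ℕ) :
    zCoeff m (C (LaurentPolynomial.T u) * q ^ n) = if u = m then X ^ n else 0 := by
  ext i
  rw [coeff_zCoeff, q, coeff_C_mul, coeff_X_pow]
  split_ifs with hi hu hu <;> simp [LaurentPolynomial.T_apply, coeff_X_pow, hi, hu]

/-- The geometric series `1 / (1 - X ^ d)`, meaningful for `d ≥ 1`. -/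
noncomputable def geom (d : ℕ) : ℤ⟦X⟧ := ∑' i : ℕ, (X ^ d) ^ i

theorem one_sub_mul_geom {d : ℕ} (hd : d ≠ 0) : (1 - X ^ d) * geom d = 1 :=
  WithPiTopology.one_sub_mul_tsum_pow_of_constantCoeff_eq_zero (by simp [hd])

theorem zCoeff_tsum_pow (m : ℤ) {u : ℤ} (hu : u.natAbs = 1) {r : ℕ} (hr : r ≠ 0) :
    zCoeff m (∑' i : ℕ, (C (LaurentPolynomial.T u) * q ^ r) ^ i) =
      if m.natAbs * u = m then X ^ (r * m.natAbs) else 0 := by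
  have hterm (i : ℕ) : zCoeff m ((C (LaurentPolynomial.T u) * q ^ r) ^ i) =
      if i * u = m then X ^ (r * i) else 0 := by
    rw [mul_pow, ← map_pow, LaurentPolynomial.T_pow, ← pow_mul, zCoeff_C_T_mul_q_pow]
  rw [(WithPiTopology.summable_pow_of_constantCoeff_eq_zero (by simp [q, hr])).map_tsum _
    (continuous_zCoeff m)]
  simp only [hterm]
  refine tsum_eq_single m.natAbs fun i hi => if_neg fun him => hi ?_
  rw [← him, Int.natAbs_mul, hu, mul_one, Int.natAbs_natCast]

/-- Partial fractions: `1 - q ^ (2 r) = (1 - z q ^ r) + (1 - z⁻¹ q ^ r) -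
(1 - z q ^ r) (1 - z⁻¹ q ^ r)`. -/
theorem one_sub_q_pow_mul_poleFactor {r : ℕ} (hr : r ≠ 0) :
    (1 - q ^ r) * ((1 + q ^ r) * poleFactor r) =
      ∑' i : ℕ, (z * q ^ r) ^ i + ∑' i : ℕ, (zInv * q ^ r) ^ i - 1 := by
  have hz : (1 - z * q ^ r) * ∑' i : ℕ, (z * q ^ r) ^ i = 1 :=
    WithPiTopology.one_sub_mul_tsum_pow_of_constantCoeff_eq_zero (by simp [q, hr])
  have hzInv : (1 - zInv * q ^ r) * ∑' i : ℕ, (zInv * q ^ r) ^ i = 1 :=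
    WithPiTopology.one_sub_mul_tsum_pow_of_constantCoeff_eq_zero (by simp [q, hr])
  linear_combination (∑' i : ℕ, (z * q ^ r) ^ i + ∑' i : ℕ, (zInv * q ^ r) ^ i - 1) *
      mul_poleFactor hr - (1 - zInv * q ^ r) * poleFactor r * hz -
    (1 - z * q ^ r) * poleFactor r * hzInv + q ^ (2 * r) * poleFactor r * z_mul_zInv

theorem zCoeff_poleFactor (m : ℤ) {r : ℕ} (hr : r ≠ 0) :
    zCoeff m ((1 + q ^ r) * poleFactor r) = X ^ (r * m.natAbs) * geom r := by
  have hsplit : zCoeff m (ofInt (1 - X ^ r) * ((1 + q ^ r) * poleFactor r)) =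
      X ^ (r * m.natAbs) := by
    have hone := zCoeff_C_T_mul_q_pow m 0 0
    rw [LaurentPolynomial.T_zero, map_one, one_mul, pow_zero] at hone
    rw [map_sub, map_one, map_pow, ofInt_X, one_sub_q_pow_mul_poleFactor hr, map_sub, map_add, z,
      zInv, zCoeff_tsum_pow m (by rfl) hr, zCoeff_tsum_pow m (by rfl) hr, hone]
    rcases lt_trichotomy m 0 with hm | rfl | hm
    · rw [if_neg (by omega), if_pos (by omega), if_neg (by omega), zero_add, sub_zero]
    · simp
    · rw [if_pos (by omega), if_neg (by omega), if_neg (by omega), add_zero, sub_zero]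
  rw [zCoeff_ofInt_mul] at hsplit
  linear_combination geom r * hsplit -
    zCoeff m ((1 + q ^ r) * poleFactor r) * one_sub_mul_geom hr

/-- The contribution of the `s`-th pole to the coefficient of `z ^ m` for `|m| = k`, in the series
built from the Bailey pair with coefficients `c`. -/
noncomputable def poleTerm (c : ℕ → ℤ⟦X⟧) (k s : ℕ) : ℤ⟦X⟧ :=
  (c s - unitCoeff X s) * X ^ (s * (k + 1)) * geom s

theorem IsBaileyPair.zCoeff_sptSeries {c : ℕ → ℤ⟦X⟧} {b : ℕ → ℕ}
    (h : IsBaileyPair invQFactorial (foldedAlpha q fun s => ofInt (c s))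
      fun n => q ^ b n * (invOddQFactorial n * invQFactorial n)) (m : ℤ) :
    zCoeff m (qPochInf (q ^ 2) (q ^ 2) * sptSeries fun n => n + b n) =
      ∑' r, poleTerm c m.natAbs (r + 1) := by
  rw [← (h.hasSum_sptSeries.map (zCoeff m) (continuous_zCoeff m)).tsum_eq]
  refine tsum_congr fun r => ?_
  have hunit : unitCoeff q (r + 1) = ofInt (unitCoeff X (r + 1)) := by
    simp [unitCoeff, ofInt_X]
  have hterm : (ofInt (c (r + 1)) - unitCoeff q (r + 1)) * (1 + q ^ (r + 1)) *
      (q ^ (r + 1) * poleFactor (r + 1)) =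
        ofInt ((c (r + 1) - unitCoeff X (r + 1)) * X ^ (r + 1)) *
          ((1 + q ^ (r + 1)) * poleFactor (r + 1)) := by
    rw [hunit, map_mul, map_sub, map_pow, ofInt_X]
    ring
  rw [Function.comp_apply, hterm, zCoeff_ofInt_mul, zCoeff_poleFactor m (r := r + 1) r.succ_ne_zero,
    poleTerm]
  ring

end ZCoefficients

section Nonnegativity

/-- The power series over `ℤ` all of whose coefficients are nonnegative. -/
def nonnegCoeff : Subsemiring ℤ⟦X⟧ where
  carrier := {f | ∀ n, 0 ≤ coeff n f}
  zero_mem' n := by simp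
  one_mem' n := by rw [coeff_one]; positivity
  add_mem' hf hg n := by simpa using add_nonneg (hf n) (hg n)
  mul_mem' hf hg n := by
    rw [coeff_mul]
    exact sum_nonneg fun p _ => mul_nonneg (hf p.1) (hg p.2)

theorem isClosed_nonnegCoeff : IsClosed (nonnegCoeff : Set ℤ⟦X⟧) := by
  have hset : (nonnegCoeff : Set ℤ⟦X⟧) = ⋂ n : ℕ, coeff n ⁻¹' Set.Ici 0 := by
    ext f
    simp [nonnegCoeff]
  rw [hset]
  exact isClosed_iInter fun n => isClosed_Ici.preimage (WithPiTopology.continuous_coeff ℤ n)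

theorem X_pow_mem_nonnegCoeff (n : ℕ) : (X : ℤ⟦X⟧) ^ n ∈ nonnegCoeff :=
  pow_mem (fun i => by rw [coeff_X]; positivity) n

theorem geom_mem_nonnegCoeff (d : ℕ) : geom d ∈ nonnegCoeff :=
  tsum_mem isClosed_nonnegCoeff fun i => pow_mem (X_pow_mem_nonnegCoeff d) i

theorem X_pow_sub_X_pow_mul_geom {d : ℕ} (hd : d ≠ 0) (a t : ℕ) :
    (X ^ a - X ^ (a + d * t)) * geom d = ∑ i ∈ range t, X ^ (a + d * i) := by
  induction t with
  | zero => simp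
  | succ t ih =>
    rw [sum_range_succ, ← ih]
    linear_combination X ^ (a + d * t) * one_sub_mul_geom hd

theorem X_pow_sub_X_pow_mul_geom_mem {d a b : ℕ} (hd : d ≠ 0) (hab : a ≤ b) (hdvd : d ∣ b - a) :
    (X ^ a - X ^ b) * geom d ∈ nonnegCoeff := by
  obtain ⟨t, ht⟩ := hdvd
  rw [show b = a + d * t by omega, X_pow_sub_X_pow_mul_geom hd]
  exact sum_mem fun i _ => X_pow_mem_nonnegCoeff _

theorem sum_X_pow_sub_sum_X_pow_mul_geom_mem {d s t : ℕ} (hd : d ≠ 0) (hst : s ≤ t)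
    {e f : ℕ → ℕ} (hle : ∀ i < s, e i ≤ f i) (hdvd : ∀ i < s, d ∣ f i - e i) :
    (∑ i ∈ range t, X ^ e i - ∑ i ∈ range s, X ^ f i) * geom d ∈ nonnegCoeff := by
  rw [← sum_range_add_sum_Ico _ hst, add_sub_right_comm, ← sum_sub_distrib, add_mul, sum_mul]
  refine add_mem (sum_mem fun i hi => ?_)
    (mul_mem (sum_mem fun i _ => X_pow_mem_nonnegCoeff _) (geom_mem_nonnegCoeff d))
  exact X_pow_sub_X_pow_mul_geom_mem hd (hle i (mem_range.mp hi)) (hdvd i (mem_range.mp hi))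

theorem geom_eq_mul_geom_two_mul {d : ℕ} (hd : d ≠ 0) :
    geom d = (1 + X ^ d) * geom (2 * d) := by
  linear_combination (1 + X ^ d) * geom (2 * d) * one_sub_mul_geom hd -
    geom d * one_sub_mul_geom (d := 2 * d) (by omega)

section EvenPartitions

theorem multipliable_of_mem_congruentOne {R : Type*} [CommRing R] [TopologicalSpace R]
    {f : ℕ → R⟦X⟧} (h : ∀ j, f j ∈ congruentOne R j) : Multipliable f := by
  have hlim : Filter.Tendsto (fun j => (f j - 1).order) Filter.atTop (𝓝 ⊤) := by
    refine ENat.tendsto_nhds_top_iff_natCast_lt.mpr fun n =>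
      Filter.eventually_atTop.mpr ⟨n + 1, fun j hj => ?_⟩
    refine lt_of_lt_of_le (Nat.cast_lt.mpr hj) (le_order _ j fun i hi => ?_)
    exact X_pow_dvd_iff.mp (h j) i (by exact_mod_cast hi)
  simpa using WithPiTopology.multipliable_one_add_of_tendsto_order_atTop_nhds_top _ hlim

theorem geom_mem_congruentOne {d N : ℕ} (hd : d ≠ 0) (h : N ≤ d) : geom d ∈ congruentOne ℤ N :=
  mem_congruentOne_of_mul_eq_one (one_sub_mem_congruentOne (pow_dvd_pow X h)) (one_sub_mul_geom hd)

/-- `1 / (X²; X²)_∞`, the generating function of partitions into even parts. -/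
noncomputable def evenPartitions : ℤ⟦X⟧ := ∏' j : ℕ, geom (2 * (j + 1))

theorem multipliable_geom (k : ℕ) : Multipliable fun j : ℕ => geom (2 * (j + k + 1)) :=
  multipliable_of_mem_congruentOne fun j => geom_mem_congruentOne (by omega) (by omega)

theorem ofInt_evenPartitions_mul : ofInt evenPartitions * qPochInf (q ^ 2) (q ^ 2) = 1 := by
  have hmul (j : ℕ) : ofInt (geom (2 * (j + 0 + 1))) * (1 - q ^ 2 * (q ^ 2) ^ j) = 1 := by
    rw [← pow_succ', ← pow_mul, ← ofInt_X, ← map_pow, ← map_one ofInt, ← map_sub, ← map_mul,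
      mul_comm, add_zero, one_sub_mul_geom (by omega)]
  have hgeom : Multipliable fun j : ℕ => ofInt (geom (2 * (j + 0 + 1))) :=
    (multipliable_geom 0).map ofInt continuous_ofInt
  have hmap : ofInt evenPartitions = ∏' j : ℕ, ofInt (geom (2 * (j + 0 + 1))) :=
    (multipliable_geom 0).map_tprod ofInt continuous_ofInt
  rw [hmap, qPochInf, ← hgeom.tprod_mul (multipliable_qPoch _ (dvd_pow_self q two_ne_zero))]
  simp only [hmul, tprod_one]

theorem exists_evenPartitions_eq_geom_two_mul :
    ∃ P ∈ nonnegCoeff, evenPartitions = geom 2 * P :=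
  ⟨∏' j : ℕ, geom (2 * (j + 1 + 1)),
    tprod_mem isClosed_nonnegCoeff fun _ => geom_mem_nonnegCoeff _,
    tprod_eq_zero_mul' (multipliable_geom 1)⟩

end EvenPartitions

theorem summable_of_X_pow_dvd {R : Type*} [CommRing R] [TopologicalSpace R] {f : ℕ → R⟦X⟧}
    (h : ∀ r, X ^ r ∣ f r) : Summable f :=
  summable_of_finite_not_X_pow_dvd fun N => (Set.finite_Iio N).subset fun r hr =>
    not_le.mp fun hle => hr ((pow_dvd_pow X hle).trans (h r))

theorem hasSum_even_add_odd_add_odd {M : Type*} [AddCommMonoid M] [TopologicalSpace M]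
    [ContinuousAdd M] [T2Space M] {f : ℕ → M} (h₀ : Summable fun l => f (2 * l))
    (h₁ : Summable fun l => f (4 * l + 1)) (h₃ : Summable fun l => f (4 * l + 3)) :
    HasSum (fun l => f (2 * l) + (f (4 * l + 1) + f (4 * l + 3))) (∑' r, f r) := by
  have hone (l : ℕ) : f (4 * l + 1) = f (2 * (2 * l) + 1) := by congr 1; ring
  have hthree (l : ℕ) : f (4 * l + 3) = f (2 * (2 * l + 1) + 1) := by congr 1; ring
  convert h₀.hasSum.add (h₁.hasSum.add h₃.hasSum)
  simp only [hone, hthree] at h₁ h₃ ⊢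
  rw [tsum_even_add_odd (f := fun l => f (2 * l + 1)) h₁ h₃,
    tsum_even_add_odd h₀ (h₁.even_add_odd h₃)]

/-- The poles of index `2 l + 1`, `4 l + 2` and `4 l + 4` taken together; for the pairs C(1) and
C(5) every negative term is compensated within its group. -/
noncomputable def poleGroup (c : ℕ → ℤ⟦X⟧) (k l : ℕ) : ℤ⟦X⟧ :=
  poleTerm c k (2 * l + 1) + (poleTerm c k (4 * l + 2) + poleTerm c k (4 * l + 4))

theorem hasSum_poleGroup (c : ℕ → ℤ⟦X⟧) (k : ℕ) :
    HasSum (poleGroup c k) (∑' r, poleTerm c k (r + 1)) := by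
  have hsummable (j : ℕ → ℕ) (hj : ∀ l, l ≤ j l) : Summable fun l => poleTerm c k (j l + 1) := by
    refine summable_of_X_pow_dvd fun l => Dvd.dvd.mul_right (Dvd.dvd.mul_left ?_ _) _
    exact pow_dvd_pow X ((Nat.le_succ_of_le (hj l)).trans (Nat.le_mul_of_pos_right _ k.succ_pos))
  exact hasSum_even_add_odd_add_odd (f := fun r => poleTerm c k (r + 1))
    (hsummable (fun l => 2 * l) fun l => by omega)
    (hsummable (fun l => 4 * l + 1) fun l => by omega)
    (hsummable (fun l => 4 * l + 3) fun l => by omega)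

theorem IsBaileyPair.coeff_sptSeries_nonneg {c : ℕ → ℤ⟦X⟧} {b : ℕ → ℕ}
    (h : IsBaileyPair invQFactorial (foldedAlpha q fun s => ofInt (c s))
      fun n => q ^ b n * (invOddQFactorial n * invQFactorial n))
    (hgroup : ∀ k l, poleGroup c k l * geom 2 ∈ nonnegCoeff) (m : ℤ) (n : ℕ) :
    0 ≤ (coeff n (sptSeries fun n => n + b n)).coeff m := by
  obtain ⟨P, hP, hPeven⟩ := exists_evenPartitions_eq_geom_two_mul
  have hsum := (hasSum_poleGroup c m.natAbs).mul_right (geom 2)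
  have hz : zCoeff m (sptSeries fun n => n + b n) =
      P * ∑' l, poleGroup c m.natAbs l * geom 2 :=
    calc zCoeff m (sptSeries fun n => n + b n)
      _ = evenPartitions *
          zCoeff m (qPochInf (q ^ 2) (q ^ 2) * sptSeries fun n => n + b n) := by
        rw [← zCoeff_ofInt_mul, ← mul_assoc, ofInt_evenPartitions_mul, one_mul]
      _ = P * ∑' l, poleGroup c m.natAbs l * geom 2 := by
        rw [h.zCoeff_sptSeries, hsum.tsum_eq, hPeven]
        ring
  rw [← coeff_zCoeff, hz]
  exact mul_mem hP (tsum_mem isClosed_nonnegCoeff (hgroup _)) n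

section PoleGroups

theorem unitCoeff_two_mul_add_one {R : Type*} [CommRing R] (x : R) (t : ℕ) :
    unitCoeff x (2 * t + 1) = -x ^ ((2 * t + 1) * t) := by
  rw [unitCoeff, Odd.neg_one_pow ⟨t, rfl⟩, Nat.choose_two_right, Nat.add_sub_cancel,
    mul_left_comm, Nat.mul_div_cancel_left _ two_pos, neg_one_mul]

theorem unitCoeff_two_mul_succ {R : Type*} [CommRing R] (x : R) (t : ℕ) :
    unitCoeff x (2 * t + 2) = x ^ ((t + 1) * (2 * t + 1)) := by
  rw [unitCoeff, Even.neg_one_pow ⟨t + 1, by ring⟩, Nat.choose_two_right,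
    show (2 * t + 2) * (2 * t + 2 - 1) = 2 * ((t + 1) * (2 * t + 1)) by
      rw [Nat.add_sub_assoc one_le_two]; ring,
    Nat.mul_div_cancel_left _ two_pos, one_mul]

variable {c : ℕ → ℤ⟦X⟧}

theorem poleTerm_two_mul_add_one (k l : ℕ) (hc : c (2 * l + 1) = 0) :
    poleTerm c k (2 * l + 1) =
      (X ^ ((2 * l + 1) * (l + k + 1)) + X ^ ((2 * l + 1) * (l + k + 2))) *
        geom (2 * (2 * l + 1)) := by
  rw [poleTerm, hc, unitCoeff_two_mul_add_one, geom_eq_mul_geom_two_mul (d := 2 * l + 1)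
    (2 * l).succ_ne_zero]
  ring

theorem poleTerm_four_mul_add_two (k l : ℕ) {e : ℕ}
    (hc : c (4 * l + 2) = -X ^ ((2 * l + 1) * e)) :
    poleTerm c k (4 * l + 2) =
      -(X ^ ((2 * l + 1) * (e + 2 * k + 2)) + X ^ ((2 * l + 1) * (4 * l + 2 * k + 3))) *
        geom (2 * (2 * l + 1)) := by
  rw [poleTerm, hc, show 4 * l + 2 = 2 * (2 * l) + 2 by ring, unitCoeff_two_mul_succ,
    show 2 * (2 * l) + 2 = 2 * (2 * l + 1) by ring]
  ring

theorem poleTerm_four_mul_add_four (k l : ℕ) {e : ℕ}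
    (hc : c (4 * l + 4) = X ^ ((2 * l + 2) * e)) :
    poleTerm c k (4 * l + 4) =
      (X ^ ((2 * l + 2) * (e + 2 * k + 2)) - X ^ ((2 * l + 2) * (4 * l + 2 * k + 5))) *
        geom (2 * (2 * l + 2)) := by
  rw [poleTerm, hc, show 4 * l + 4 = 2 * (2 * l + 1) + 2 by ring, unitCoeff_two_mul_succ,
    show 2 * (2 * l + 1) + 2 = 2 * (2 * l + 2) by ring]
  ring

theorem add_succ_eq_odd_add_even {M : Type*} [AddCommMagma M] (f : ℕ → M) (p : ℕ) :
    f p + f (p + 1) = f (2 * (p / 2) + 1) + f (2 * ((p + 1) / 2)) := by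
  rcases Nat.even_or_odd' p with ⟨t, rfl | rfl⟩
  · rw [add_comm, show 2 * t / 2 = t by omega, show (2 * t + 1) / 2 = t by omega]
  · rw [show (2 * t + 1) / 2 = t by omega, show (2 * t + 1 + 1) / 2 = t + 1 by omega]
    rfl

/-- Modulo `2 (2 l + 1)` the exponents of the positive terms are distinguished by the parity of the
cofactor of `2 l + 1`, which decides which negative term each of them is to absorb. -/
theorem poleTerm_add_poleTerm (k l : ℕ) {e : ℕ} (hodd : c (2 * l + 1) = 0)
    (heven : c (4 * l + 2) = -X ^ ((2 * l + 1) * e)) :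
    poleTerm c k (2 * l + 1) + poleTerm c k (4 * l + 2) =
      (X ^ ((2 * l + 1) * (2 * ((l + k + 1) / 2) + 1)) -
          X ^ ((2 * l + 1) * (4 * l + 2 * k + 3))) * geom (2 * (2 * l + 1)) +
        (X ^ ((2 * l + 1) * (2 * ((l + k + 2) / 2))) - X ^ ((2 * l + 1) * (e + 2 * k + 2))) *
          geom (2 * (2 * l + 1)) := by
  rw [poleTerm_two_mul_add_one k l hodd, poleTerm_four_mul_add_two k l heven]
  linear_combination geom (2 * (2 * l + 1)) *
    add_succ_eq_odd_add_even (fun p => X ^ ((2 * l + 1) * p) : ℕ → ℤ⟦X⟧) (l + k + 1)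

theorem mul_two_mul_dvd_sub {n a b : ℕ} (h : 2 ∣ b - a) : 2 * n ∣ n * b - n * a := by
  rw [← Nat.mul_sub, mul_comm 2]
  exact Nat.mul_dvd_mul_left n h

theorem X_pow_mul_sub_X_pow_mul_mul_geom_mem {n a b : ℕ} (hn : n ≠ 0) (hab : a ≤ b)
    (h : 2 ∣ b - a) : (X ^ (n * a) - X ^ (n * b)) * geom (2 * n) ∈ nonnegCoeff :=
  X_pow_sub_X_pow_mul_geom_mem (by omega) (Nat.mul_le_mul_left n hab) (mul_two_mul_dvd_sub h)

theorem ofInt_slaterC5Coeff (s : ℕ) : ofInt (slaterC5Coeff X s) = slaterC5Coeff q s := by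
  simp [slaterC5Coeff, apply_ite ofInt, ofInt_X]

theorem ofInt_slaterC1Coeff (s : ℕ) : ofInt (slaterC1Coeff X s) = slaterC1Coeff q s := by
  simp [slaterC1Coeff, apply_ite ofInt, ofInt_X]

theorem poleGroup_slaterC5_mem (k l : ℕ) :
    poleGroup (slaterC5Coeff X) k l * geom 2 ∈ nonnegCoeff := by
  have htwo : slaterC5Coeff (X : ℤ⟦X⟧) (4 * l + 2) = -X ^ ((2 * l + 1) * (2 * l)) := by
    rw [show 4 * l + 2 = 2 * (2 * l) + 2 by ring, slaterC5Coeff_two_mul_succ,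
      Odd.neg_one_pow ⟨l, rfl⟩, neg_one_mul]
  have hfour : slaterC5Coeff (X : ℤ⟦X⟧) (4 * l + 4) = X ^ ((2 * l + 2) * (2 * l + 1)) := by
    rw [show 4 * l + 4 = 2 * (2 * l + 1) + 2 by ring, slaterC5Coeff_two_mul_succ,
      Even.neg_one_pow ⟨l + 1, by ring⟩, one_mul]
  rw [poleGroup, ← add_assoc, poleTerm_add_poleTerm k l (slaterC5Coeff_two_mul_add_one X l) htwo,
    poleTerm_four_mul_add_four k l hfour]
  refine mul_mem (add_mem (add_mem ?_ ?_) ?_) (geom_mem_nonnegCoeff 2) <;>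
    exact X_pow_mul_sub_X_pow_mul_mul_geom_mem (by omega) (by omega) (by omega)

theorem slaterC1_excess_mem (k l : ℕ) :
    ((X ^ ((2 * l + 1) * (2 * ((l + k + 2) / 2))) - X ^ ((2 * l + 1) * (6 * l + 2 * k + 4))) *
          geom (2 * (2 * l + 1)) +
        (X ^ ((2 * l + 2) * (6 * l + 2 * k + 7)) - X ^ ((2 * l + 2) * (4 * l + 2 * k + 5))) *
          geom (2 * (2 * l + 2))) * geom 2 ∈ nonnegCoeff := by
  obtain ⟨b, hb⟩ : ∃ b, (l + k + 2) / 2 = b := ⟨_, rfl⟩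
  have hpos := X_pow_sub_X_pow_mul_geom (d := 2 * (2 * l + 1)) (by omega)
    ((2 * l + 1) * (2 * b)) (3 * l + k + 2 - b)
  have hneg := X_pow_sub_X_pow_mul_geom (d := 2 * (2 * l + 2)) (by omega)
    ((2 * l + 2) * (4 * l + 2 * k + 5)) (l + 1)
  rw [show (2 * l + 1) * (2 * b) + 2 * (2 * l + 1) * (3 * l + k + 2 - b) =
    (2 * l + 1) * (6 * l + 2 * k + 4) by
      rw [mul_comm 2 (2 * l + 1), mul_assoc, ← mul_add]; congr 1; omega] at hpos
  rw [show (2 * l + 2) * (4 * l + 2 * k + 5) + 2 * (2 * l + 2) * (l + 1) =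
    (2 * l + 2) * (6 * l + 2 * k + 7) by ring] at hneg
  rw [hb, hpos, ← neg_sub (X ^ ((2 * l + 2) * (4 * l + 2 * k + 5))), neg_mul, hneg,
    ← sub_eq_add_neg]
  refine sum_X_pow_sub_sum_X_pow_mul_geom_mem two_ne_zero (by omega) (fun i _ => ?_) fun i _ => ?_
  · exact add_le_add (Nat.mul_le_mul (by omega) (by omega))
      (Nat.mul_le_mul_right i (by omega))
  · have heven : 2 ∣ (2 * l + 2) * (4 * l + 2 * k + 5) := ⟨(l + 1) * (4 * l + 2 * k + 5), by ring⟩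
    exact Nat.dvd_sub (heven.add (dvd_mul_of_dvd_left (dvd_mul_right _ _) i))
      ((dvd_mul_of_dvd_right (dvd_mul_right _ _) _).add
        (dvd_mul_of_dvd_left (dvd_mul_right _ _) i))

theorem poleGroup_slaterC1_mem (k l : ℕ) :
    poleGroup (slaterC1Coeff X) k l * geom 2 ∈ nonnegCoeff := by
  have htwo : slaterC1Coeff (X : ℤ⟦X⟧) (4 * l + 2) = -X ^ ((2 * l + 1) * (6 * l + 2)) := by
    rw [show 4 * l + 2 = 2 * (2 * l) + 2 by ring, slaterC1Coeff_two_mul_succ,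
      Odd.neg_one_pow ⟨l, rfl⟩, neg_one_mul]
    ring
  have hfour : slaterC1Coeff (X : ℤ⟦X⟧) (4 * l + 4) = X ^ ((2 * l + 2) * (6 * l + 5)) := by
    rw [show 4 * l + 4 = 2 * (2 * l + 1) + 2 by ring, slaterC1Coeff_two_mul_succ,
      Even.neg_one_pow ⟨l + 1, by ring⟩, one_mul]
    ring
  rw [poleGroup, ← add_assoc, poleTerm_add_poleTerm k l (slaterC1Coeff_two_mul_add_one X l) htwo,
    poleTerm_four_mul_add_four k l hfour, add_assoc, add_mul]
  refine add_mem (mul_mem ?_ (geom_mem_nonnegCoeff 2)) ?_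
  · exact X_pow_mul_sub_X_pow_mul_mul_geom_mem (by omega) (by omega) (by omega)
  · convert slaterC1_excess_mem k l using 6 <;> ring

end PoleGroups

end Nonnegativity

theorem MC1_nonneg (m : ℤ) (n : ℕ) : 0 ≤ MC1 m n := by
  have hpair := isBaileyPair_slaterC1 isInvProd_invQFactorial isInvProd_invOddQFactorial
  refine IsBaileyPair.coeff_sptSeries_nonneg (c := slaterC1Coeff X) (b := 0) ?_
    poleGroup_slaterC1_mem m n
  simpa only [ofInt_slaterC1Coeff, Pi.zero_apply, pow_zero, one_mul] using hpair

theorem MC5_nonneg (m : ℤ) (n : ℕ) : 0 ≤ MC5 m n := by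
  have hpair := isBaileyPair_slaterC5 isInvProd_invQFactorial isInvProd_invOddQFactorial
  have hexp : (fun n : ℕ => n * (n + 1) / 2) = fun n => n + n.choose 2 := by
    funext n
    have htriangle := Nat.choose_two_right (n + 1)
    rw [Nat.add_sub_cancel, Nat.choose_succ_succ' n 1, Nat.choose_one_right] at htriangle
    rw [htriangle, mul_comm]
  rw [MC5, SC5, hexp]
  refine IsBaileyPair.coeff_sptSeries_nonneg (c := slaterC5Coeff X) ?_ poleGroup_slaterC5_mem m n
  simpa only [ofInt_slaterC5Coeff] using hpair

end SptCrank

theorem mainTheorem1 (m : ℤ) (n : ℕ) (hn : 1 ≤ n) :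
    0 ≤ SptCrank.MC1 m n ∧ 0 ≤ SptCrank.MC5 m n :=
  ⟨SptCrank.MC1_nonneg m n, SptCrank.MC5_nonneg m n⟩
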